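/- Let $m\ge 3$ be fixed, let $(A_i)_{i\in\mathbb N}$ be i.i.d. random vectors uniformly distributed on the unit sphere $S^{m-1}\subset\mathbb R^m$, and let $A^{[n]}$ be the random $n\times m$ matrix with rows $A_1,\dots,A_n$. For a real $n\times m$ matrix $A$ with nonzero rows $a_1,\dots,a_n$, $n\ge1$, put $$\theta(A)=\sup_{x\in\mathbb R^m\setminus\{0\}}\ \min_{1\le i\le n}\arccos\frac{a_i\cdot x}{\|a_i\|\,\|x\|},\qquad \mathscr C(A)=|\cos\theta(A)|^{-1}\in[1,\infty],$$ with $\mathscr C(A)=\infty$ and $\log\mathscr C(A)=\infty$ if $\theta(A)=\pi/2$. Then $$\lim_{n\to\infty}\mathbf E\bigl[(\log\mathscr C(A^{[n]}))^{\gamma}\bigr]=0\qquad\text{for every }\gamma>0.$$ In particular, $\log\mathscr C(A^{[n]})$ (which for every $n\ge m$ is almost surely finite and square integrable) satisfies $$\lim_{n\to\infty}\mathbf E\bigl[\log\mathscr C(A^{[n]})\bigr]=0\qquad\text{and}\qquad\lim_{n\to\infty}\mathbf{VAR}\bigl(\log\mathscr C(A^{[n]})\bigr)=0.$$ -/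

import Mathlib

open MeasureTheory ProbabilityTheory Filter Topology
open scoped ENNReal

namespace CondNumber

/-- The `i`-th row `a_i` of a real `n × m` matrix, as a vector of Euclidean space `ℝ^m`. -/
noncomputable def row {n m : ℕ} (A : Matrix (Fin n) (Fin m) ℝ) (i : Fin n) :
    EuclideanSpace ℝ (Fin m) :=
  WithLp.toLp 2 (A i)

/-- `θ(A, x) = min_i θ_i(A, x)`, where `θ_i(A, x) = arccos (a_i ⬝ x / (‖a_i‖ ‖x‖))` is the angle
between the `i`-th row `a_i` of `A` and `x`. -/
noncomputable def minAngle {n m : ℕ} (A : Matrix (Fin n) (Fin m) ℝ)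
    (x : EuclideanSpace ℝ (Fin m)) : ℝ :=
  ⨅ i : Fin n, InnerProductGeometry.angle (row A i) x

/-- `θ(A) = sup_{x ≠ 0} θ(A, x)`. -/
noncomputable def theta {n m : ℕ} (A : Matrix (Fin n) (Fin m) ℝ) : ℝ :=
  ⨆ x : {x : EuclideanSpace ℝ (Fin m) // x ≠ 0}, minAngle A x

/-- The condition number `𝒞(A) = |cos θ(A)|⁻¹ ∈ [1, ∞]`; it is `∞` when `θ(A) = π / 2`. -/
noncomputable def condNumber {n m : ℕ} (A : Matrix (Fin n) (Fin m) ℝ) : ℝ≥0∞ :=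
  (ENNReal.ofReal |Real.cos (theta A)|)⁻¹

theorem one_le_condNumber {n m : ℕ} (A : Matrix (Fin n) (Fin m) ℝ) : 1 ≤ condNumber A := by
  rw [condNumber, ENNReal.one_le_inv, ENNReal.ofReal_le_one]
  exact Real.abs_cos_le_one _

/-- `log 𝒞(A) ∈ [0, ∞]`, with `log ∞ = ∞`. The passage from `EReal` to `ℝ≥0∞` loses nothing, see
`coe_logCondNumber`. -/
noncomputable def logCondNumber {n m : ℕ} (A : Matrix (Fin n) (Fin m) ℝ) : ℝ≥0∞ :=
  (ENNReal.log (condNumber A)).toENNReal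

theorem coe_logCondNumber {n m : ℕ} (A : Matrix (Fin n) (Fin m) ℝ) :
    (logCondNumber A : EReal) = ENNReal.log (condNumber A) := by
  refine EReal.coe_toENNReal ?_
  rw [← ENNReal.log_one]
  exact ENNReal.log_monotone (one_le_condNumber A)

/-- The uniform probability measure on the unit sphere of `ℝ^m`: the normalised surface measure. -/
noncomputable def uniformSphere (m : ℕ) :
    Measure (Metric.sphere (0 : EuclideanSpace ℝ (Fin m)) 1) :=
  ((volume : Measure (EuclideanSpace ℝ (Fin m))).toSphere Set.univ)⁻¹ •
    (volume : Measure (EuclideanSpace ℝ (Fin m))).toSphere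

theorem isProbabilityMeasure_uniformSphere (m : ℕ) (hm : 1 ≤ m) :
    IsProbabilityMeasure (uniformSphere m) := by
  constructor
  have : Nonempty (Fin m) := ⟨⟨0, hm⟩⟩
  rw [uniformSphere, Measure.smul_apply, smul_eq_mul]
  refine ENNReal.inv_mul_cancel ?_ (measure_ne_top _ _)
  rw [Measure.toSphere_apply_univ]
  refine mul_ne_zero ?_ (Metric.measure_ball_pos _ _ one_pos).ne'
  simp; omega

/-- The `n × m` matrix `A^{[n]}(ω)` with rows the first `n` terms of the sequence of random vectors
(indexed from `0`): `A 0 ω, …, A (n - 1) ω`. -/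
noncomputable def rowMatrix {Ω : Type*} {m : ℕ}
    (A : ℕ → Ω → Metric.sphere (0 : EuclideanSpace ℝ (Fin m)) 1) (n : ℕ) (ω : Ω) :
    Matrix (Fin n) (Fin m) ℝ :=
  Matrix.of fun i j => (A i ω : EuclideanSpace ℝ (Fin m)) j

end CondNumber

/-! Two estimates of opposite strength are played against each other. Finitely many balls of radius
`r`, each of positive measure, cover the sphere. A union bound shows that the first `n` rows meet
all of them except with probability at most `N * q ^ n`, `q < 1` (`exists_measure_cos_theta_lt_le`).
When they do, `cos θ ≥ 1 - 2 r²`, so `log 𝒞` is uniformly small for small `r`. On the exceptional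
event `log 𝒞` is unbounded, but its moments grow only polynomially in `n`. Indeed `c = cos θ` is the
minimum over unit `x` of `max_i ⟪a_i, x⟫`. First-order optimality makes `c x` a convex combination
of at most `m` rows, which forces some `m × m` minor to be at most `m * m! * |c|`
(`exists_minor_le_abs_cos_theta`). Each fixed minor has `|det|^{-1/2}` integrable, with a bound
independent of the rows chosen. Summing over at most `n ^ m` minors, Cauchy–Schwarz bounds the part
of the moment on a set `T` by `K * n ^ m * P(T)^{1/2}`
(`exists_setLIntegral_logCondNumber_rpow_le`), and exponential decay beats the polynomial. -/

namespace CondNumber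

/-! ### Deterministic geometry: `cos θ`, minors and nets -/

/-- For unit rows, `θ(A)` is attained, and `cos θ(A)` is the minimum over the unit sphere of
`max_i ⟪a_i, x⟫`. -/
theorem theta_attained {n m : ℕ} (hn : 1 ≤ n) (hm : 1 ≤ m) (A : Matrix (Fin n) (Fin m) ℝ)
    (hA : ∀ i, ‖row A i‖ = 1) :
    ∃ x : EuclideanSpace ℝ (Fin m), ‖x‖ = 1 ∧ (∀ i, inner ℝ (row A i) x ≤ Real.cos (theta A)) ∧
      ∀ y : EuclideanSpace ℝ (Fin m), y ≠ 0 →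
        ∃ i, Real.cos (theta A) * ‖y‖ ≤ inner ℝ (row A i) y := by
  have : Nonempty (Fin n) := ⟨⟨0, hn⟩⟩
  have : Nonempty (Fin m) := ⟨⟨0, hm⟩⟩
  have hne : ∀ i, row A i ≠ 0 := fun i h => by simpa [h] using hA i
  have hcont : ContinuousOn (minAngle A) (Metric.sphere 0 1) := by
    have : minAngle A = fun x => Finset.univ.inf' Finset.univ_nonempty
        fun i => InnerProductGeometry.angle (row A i) x := by
      funext x
      rw [Finset.inf'_univ_eq_ciInf]
      rfl
    rw [this]
    refine ContinuousOn.finset_inf'_apply _ fun i _ x hx => ?_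
    have hx0 : x ≠ 0 := fun h => by simp [h] at hx
    exact ((InnerProductGeometry.continuousAt_angle (x := (row A i, x)) (hne i) hx0).comp
      (f := fun y => (row A i, y)) (by fun_prop)).continuousWithinAt
  obtain ⟨x, hx, hmax⟩ := (isCompact_sphere (0 : EuclideanSpace ℝ (Fin m)) 1).exists_isMaxOn
    (NormedSpace.sphere_nonempty.2 zero_le_one) hcont
  have hx1 : ‖x‖ = 1 := by simpa using hx
  have hle : ∀ y : EuclideanSpace ℝ (Fin m), y ≠ 0 → minAngle A y ≤ minAngle A x := by
    intro y hy
    have h1 : minAngle A (‖y‖⁻¹ • y) = minAngle A y := by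
      simp only [minAngle]
      congr 1
      funext i
      exact InnerProductGeometry.angle_smul_right_of_pos _ _ (by positivity)
    rw [← h1]
    apply hmax
    simp [norm_smul, hy]
  have hx0 : x ≠ 0 := fun h => by simp [h] at hx
  have htheta : theta A = minAngle A x := by
    have : Nonempty {x : EuclideanSpace ℝ (Fin m) // x ≠ 0} := ⟨⟨x, hx0⟩⟩
    refine le_antisymm (ciSup_le fun y => hle y y.2) ?_
    exact le_ciSup (f := fun y : {x : EuclideanSpace ℝ (Fin m) // x ≠ 0} => minAngle A y)
      ⟨minAngle A x, by rintro _ ⟨y, rfl⟩; exact hle y y.2⟩ ⟨x, hx0⟩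
  have hbdd : ∀ y, BddBelow (Set.range fun i => InnerProductGeometry.angle (row A i) y) :=
    fun y => (Set.finite_range _).bddBelow
  have hnonneg : 0 ≤ minAngle A x :=
    le_ciInf fun i => InnerProductGeometry.angle_nonneg _ _
  refine ⟨x, hx1, fun i => ?_, fun y hy => ?_⟩
  · have h1 : minAngle A x ≤ InnerProductGeometry.angle (row A i) x := ciInf_le (hbdd x) i
    have h2 := Real.cos_le_cos_of_nonneg_of_le_pi hnonneg (InnerProductGeometry.angle_le_pi _ _) h1
    rw [InnerProductGeometry.cos_angle, hA, hx1] at h2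
    simpa [htheta] using h2
  · obtain ⟨i, hi⟩ := exists_eq_ciInf_of_finite
      (f := fun i => InnerProductGeometry.angle (row A i) y)
    refine ⟨i, ?_⟩
    have h1 : InnerProductGeometry.angle (row A i) y ≤ theta A := by
      rw [hi, htheta]; exact hle y hy
    have h2 := Real.cos_le_cos_of_nonneg_of_le_pi (InnerProductGeometry.angle_nonneg _ _)
      (htheta ▸ (ciInf_le (hbdd x) i).trans (InnerProductGeometry.angle_le_pi _ _)) h1
    rwa [InnerProductGeometry.cos_angle, hA, one_mul, le_div_iff₀ (norm_pos_iff.2 hy)] at h2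

/-- At a minimiser `x` of `max_i ⟪a_i, x⟫` on the unit sphere, with minimum `c`, the vector `c x` is
a convex combination of the `a_i` that attain the maximum. -/
theorem smul_mem_convexHull_of_minimax {ι E : Type*} [Finite ι] [NormedAddCommGroup E]
    [InnerProductSpace ℝ E] [FiniteDimensional ℝ E] (a : ι → E) (x : E) (c : ℝ)
    (hx : ‖x‖ = 1) (hle : ∀ i, inner ℝ (a i) x ≤ c)
    (hmin : ∀ y : E, y ≠ 0 → ∃ i, c * ‖y‖ ≤ inner ℝ (a i) y) :
    c • x ∈ convexHull ℝ (a '' {i | inner ℝ (a i) x = c}) := by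
  by_contra hnot
  obtain ⟨f, u, hf, hu⟩ := geometric_hahn_banach_closed_point
    (convex_convexHull ℝ (a '' {i | inner ℝ (a i) x = c}))
    (((Set.toFinite _).image a).isClosed_convexHull ℝ) hnot
  -- The separating direction `y` satisfies `⟪a_i, y⟫ < ⟪c x, y⟫` for every active `i`, so moving
  -- from `x` along `y` should beat the minimum.
  set y : E := (InnerProductSpace.toDual ℝ E).symm f with hy
  have hfy : ∀ z, f z = inner ℝ z y := fun z => by
    rw [real_inner_comm, hy, InnerProductSpace.toDual_symm_apply]
  have hnorm : HasDerivAt (fun t : ℝ => ‖x + t • y‖) (inner ℝ x y) 0 := by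
    have h1 : HasDerivAt (fun t : ℝ => ‖x + t • y‖ ^ 2) (2 * inner ℝ x y) 0 := by
      have h2 : HasDerivAt (fun t : ℝ => x + t • y) y 0 := by
        simpa using ((hasDerivAt_id (0 : ℝ)).smul_const y).const_add x
      simpa using h2.norm_sq
    have h3 := h1.sqrt (by simp [hx])
    simpa [hx, Real.sqrt_sq] using h3
  have hev : ∀ i, ∀ᶠ t in 𝓝[>] (0 : ℝ), inner ℝ (a i) (x + t • y) < c * ‖x + t • y‖ := by
    -- Inactive constraints stay strict by continuity. For active ones the gap vanishes at `t = 0`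
    -- and has derivative `⟪c x - a_i, y⟫ > 0`.
    intro i
    rcases (hle i).lt_or_eq with h | h
    · have hc : Continuous fun t : ℝ => c * ‖x + t • y‖ - inner ℝ (a i) (x + t • y) := by fun_prop
      have h0 : ∀ᶠ t in 𝓝 (0 : ℝ), 0 < c * ‖x + t • y‖ - inner ℝ (a i) (x + t • y) :=
        hc.continuousAt.eventually_const_lt (by simpa [hx] using h)
      filter_upwards [h0.filter_mono nhdsWithin_le_nhds] with t ht
      linarith
    · have hd : HasDerivAt (fun t : ℝ => c * ‖x + t • y‖ - inner ℝ (a i) (x + t • y))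
          (c * inner ℝ x y - inner ℝ (a i) y) 0 := by
        refine (hnorm.const_mul c).sub ?_
        have : (fun t : ℝ => inner ℝ (a i) (x + t • y))
            = fun t : ℝ => inner ℝ (a i) x + t * inner ℝ (a i) y := by
          funext t; rw [inner_add_right, inner_smul_right]
        rw [this]
        simpa using ((hasDerivAt_id (0 : ℝ)).mul_const (inner ℝ (a i) y)).const_add
          (inner ℝ (a i) x)
      have hpos : 0 < c * inner ℝ x y - inner ℝ (a i) y := by
        have h1 := hf _ (subset_convexHull ℝ _ ⟨i, h, rfl⟩)
        rw [hfy] at h1 hu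
        rw [inner_smul_left] at hu
        simp at hu
        linarith
      have hs := (hasDerivAt_iff_tendsto_slope.1 hd).mono_left
        (nhdsWithin_mono _ fun t (ht : 0 < t) => ht.ne')
      filter_upwards [hs.eventually_const_lt hpos, self_mem_nhdsWithin] with t ht ht0
      rw [slope_def_field] at ht
      simp only [zero_smul, add_zero, hx, h, sub_zero, mul_one, sub_self] at ht
      have := (div_pos_iff_of_pos_right (show (0:ℝ) < t from ht0)).1 ht
      linarith
  have hne : ∀ᶠ t in 𝓝[>] (0 : ℝ), x + t • y ≠ 0 := by
    have hc : Continuous fun t : ℝ => x + t • y := by fun_prop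
    refine (hc.continuousAt.eventually_ne (x := 0) (y := 0) ?_).filter_mono nhdsWithin_le_nhds
    rintro h
    simp [show x = 0 by simpa using h] at hx
  obtain ⟨t, ht, ht'⟩ := ((eventually_all.2 hev).and hne).exists
  obtain ⟨i, hi⟩ := hmin _ ht'
  exact absurd (ht i) hi.not_gt

/-- A point of height `c` in the convex hull of points of height `c` over `x ≠ 0` is a convex
combination of at most `dim E` of them. -/
theorem exists_finset_convex_combination {ι E : Type*} [Fintype ι] [NormedAddCommGroup E]
    [InnerProductSpace ℝ E] [FiniteDimensional ℝ E] (a : ι → E) (x p : E) (c : ℝ) (hx : x ≠ 0)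
    (hp : p ∈ convexHull ℝ (a '' {i | inner ℝ (a i) x = c})) :
    ∃ (s : Finset ι) (w : ι → ℝ), s.card ≤ Module.finrank ℝ E ∧ (∀ i, 0 ≤ w i) ∧
      (∀ i, i ∉ s → w i = 0) ∧ ∑ i ∈ s, w i = 1 ∧ ∑ i ∈ s, w i • a i = p := by
  classical
  obtain ⟨κ, _, z, w, hz, hind, hw, hsum, hp⟩ := eq_pos_convex_span_of_mem_convexHull hp
  choose k hk hka using fun j => hz (Set.mem_range_self j)
  have hkinj : Function.Injective k := fun i j h => hind.injective (by rw [← hka, ← hka, h])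
  have hcard : Fintype.card κ ≤ Module.finrank ℝ E := by
    have h1 := hind.card_le_finrank_succ
    -- All the points lie in one hyperplane of normal `x`, which saves one point over Carathéodory's
    -- `dim E + 1`.
    have h2 : vectorSpan ℝ (Set.range z) ≤ (ℝ ∙ x)ᗮ := by
      rw [vectorSpan_def, Submodule.span_le]
      rintro _ ⟨_, ⟨i, rfl⟩, _, ⟨j, rfl⟩, rfl⟩
      have hi : inner ℝ (a (k i)) x = c := hk i
      have hj : inner ℝ (a (k j)) x = c := hk j
      simp only [SetLike.mem_coe, Submodule.mem_orthogonal_singleton_iff_inner_left, vsub_eq_sub,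
        inner_sub_left, ← hka, hi, hj, sub_self]
    have h3 := Submodule.finrank_mono h2
    have h4 := Submodule.finrank_add_finrank_orthogonal (ℝ ∙ x)
    rw [finrank_span_singleton hx] at h4
    omega
  refine ⟨Finset.univ.image k, Function.extend k w 0, ?_, fun i => ?_, fun i hi => ?_, ?_, ?_⟩
  · exact Finset.card_image_le.trans hcard
  · by_cases h : ∃ j, k j = i
    · obtain ⟨j, rfl⟩ := h
      rw [hkinj.extend_apply]
      exact (hw j).le
    · rw [Function.extend_apply' _ _ _ h]; rfl
  · refine Function.extend_apply' _ _ _ fun ⟨j, hj⟩ => hi ?_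
    exact Finset.mem_image.2 ⟨j, Finset.mem_univ _, hj⟩
  · rw [Finset.sum_image hkinj.injOn, ← hsum]
    exact Finset.sum_congr rfl fun j _ => hkinj.extend_apply _ _ _
  · rw [Finset.sum_image hkinj.injOn, ← hp]
    exact Finset.sum_congr rfl fun j _ => by rw [hkinj.extend_apply, hka]

/-- Some weight is at least `1 / m`. Replacing that row by the weighted sum of all rows multiplies
the determinant by this weight, while the new row is `c • x`; the Leibniz formula bounds what
remains by `m!`. -/
theorem abs_det_le_of_convex_combination {m : ℕ} (M : Matrix (Fin m) (Fin m) ℝ)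
    (hM : ∀ i j, |M i j| ≤ 1) (w : Fin m → ℝ) (hw : ∀ i, 0 ≤ w i) (hsum : ∑ i, w i = 1)
    (x : Fin m → ℝ) (hx : ∀ j, |x j| ≤ 1) (c : ℝ) (hc : ∑ i, w i • M i = c • x) :
    |M.det| ≤ m * m.factorial * |c| := by
  have hm : 0 < m := by
    rcases Nat.eq_zero_or_pos m with rfl | h
    · simp at hsum
    · exact h
  obtain ⟨j, hj⟩ : ∃ j, 1 / (m : ℝ) ≤ w j := by
    by_contra! h
    have : ∑ i, w i < ∑ _i : Fin m, 1 / (m : ℝ) :=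
      Finset.sum_lt_sum_of_nonempty ⟨⟨0, hm⟩, Finset.mem_univ _⟩ fun i _ => h i
    rw [hsum] at this
    simp [hm.ne'] at this
  have h1 := Matrix.det_updateRow_sum M j w
  rw [hc, Matrix.det_updateRow_smul] at h1
  have h2 : |(M.updateRow j x).det| ≤ m.factorial := by
    have := Matrix.det_le (A := M.updateRow j x) (abv := AbsoluteValue.abs) (x := 1) fun i k => by
      rw [AbsoluteValue.abs_apply, Matrix.updateRow_apply]
      split_ifs
      exacts [hx k, hM i k]
    simpa using this
  have h3 : w j * |M.det| ≤ |c| * m.factorial := by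
    have := congrArg abs h1
    rw [smul_eq_mul, abs_mul, abs_mul, abs_of_nonneg (hw j)] at this
    rw [← this]
    gcongr
  have h4 : 1 / (m : ℝ) * |M.det| ≤ |c| * m.factorial :=
    (mul_le_mul_of_nonneg_right hj (abs_nonneg _)).trans h3
  rw [one_div, inv_mul_le_iff₀ (by positivity)] at h4
  linarith

theorem abs_le_one_of_norm_le_one {m : ℕ} {x : EuclideanSpace ℝ (Fin m)} (hx : ‖x‖ ≤ 1)
    (j : Fin m) : |x j| ≤ 1 :=
  (PiLp.norm_apply_le x j).trans hx

/-- The condition number of a matrix with unit rows is controlled by one of its maximal minors. -/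
theorem exists_minor_le_abs_cos_theta {n m : ℕ} (hm : 1 ≤ m) (hn : m ≤ n)
    (A : Matrix (Fin n) (Fin m) ℝ) (hA : ∀ i, ‖row A i‖ = 1) :
    ∃ e : Fin m ↪ Fin n, |(A.submatrix e id).det| ≤ m * m.factorial * |Real.cos (theta A)| := by
  obtain ⟨x, hx, hle, hmin⟩ := theta_attained (hm.trans hn) hm A hA
  obtain ⟨s, w, hs, hw, hw0, hsum, hcomb⟩ := exists_finset_convex_combination (row A) x _ _
    (fun h => by simp [h] at hx) (smul_mem_convexHull_of_minimax _ x _ hx hle hmin)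
  rw [finrank_euclideanSpace_fin] at hs
  -- Pad with rows of weight zero to get exactly `m` of them.
  obtain ⟨t, hst, -, ht⟩ := Finset.exists_subsuperset_card_eq (Finset.subset_univ s) hs (by simpa)
  have himg : Finset.univ.map (t.orderEmbOfFin ht).toEmbedding = t := by
    simp
  refine ⟨(t.orderEmbOfFin ht).toEmbedding, abs_det_le_of_convex_combination _ (fun i j =>
    abs_le_one_of_norm_le_one (hA _).le j) (fun i => w (t.orderEmbOfFin ht i)) (fun i => hw _) ?_
    x.ofLp (abs_le_one_of_norm_le_one hx.le) _ ?_⟩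
  · rw [← hsum, Finset.sum_subset hst fun i _ hi => hw0 i hi]
    conv_rhs => rw [← himg, Finset.sum_map]
    rfl
  · rw [Finset.sum_subset hst fun i _ hi => by rw [hw0 i hi, zero_smul], ← himg,
      Finset.sum_map] at hcomb
    have := congrArg WithLp.ofLp hcomb
    rw [WithLp.ofLp_smul, WithLp.ofLp_sum] at this
    exact this

/-- If the unit rows of `A` meet every ball of a cover of the unit sphere by balls of radius `r`,
then `cos θ(A) ≥ 1 - 2 r²`. -/
theorem le_cos_theta_of_net {n m : ℕ} (hn : 1 ≤ n) (hm : 1 ≤ m) (A : Matrix (Fin n) (Fin m) ℝ)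
    (hA : ∀ i, ‖row A i‖ = 1) (r : ℝ)
    (h : ∀ y : EuclideanSpace ℝ (Fin m), ‖y‖ = 1 → ∃ i, dist (row A i) y ≤ 2 * r) :
    1 - 2 * r ^ 2 ≤ Real.cos (theta A) := by
  obtain ⟨x, hx, hle, -⟩ := theta_attained hn hm A hA
  obtain ⟨i, hi⟩ := h x hx
  refine le_trans ?_ (hle i)
  have h1 := norm_sub_sq_real (row A i) x
  rw [dist_eq_norm] at hi
  rw [hA, hx] at h1
  nlinarith [norm_nonneg (row A i - x)]

/-! ### Integrals of `|y|^{-1/2}` over the interval, the cube and the sphere -/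

/-- `|y|^{-1/2}`, with value `∞` at `0`. -/
noncomputable def invSqrtAbs (y : ℝ) : ℝ≥0∞ := ENNReal.ofReal |y| ^ (-(1 / 2) : ℝ)

@[fun_prop]
theorem measurable_invSqrtAbs : Measurable invSqrtAbs := by
  unfold invSqrtAbs
  fun_prop

theorem invSqrtAbs_mul (x y : ℝ) : invSqrtAbs (x * y) = invSqrtAbs x * invSqrtAbs y := by
  rw [invSqrtAbs, invSqrtAbs, invSqrtAbs, abs_mul, ENNReal.ofReal_mul (abs_nonneg _),
    ENNReal.mul_rpow_of_ne_top ENNReal.ofReal_ne_top ENNReal.ofReal_ne_top]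

theorem invSqrtAbs_le_invSqrtAbs {x y : ℝ} (h : |x| ≤ |y|) : invSqrtAbs y ≤ invSqrtAbs x := by
  rw [invSqrtAbs, invSqrtAbs, ENNReal.rpow_neg, ENNReal.rpow_neg, ENNReal.inv_le_inv]
  gcongr

@[simp] theorem invSqrtAbs_zero : invSqrtAbs 0 = ∞ := by
  simp [invSqrtAbs]

@[simp] theorem invSqrtAbs_one : invSqrtAbs 1 = 1 := by
  simp [invSqrtAbs]

@[simp] theorem invSqrtAbs_neg (x : ℝ) : invSqrtAbs (-x) = invSqrtAbs x := by
  simp [invSqrtAbs]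

theorem invSqrtAbs_eq_ofReal {x : ℝ} (hx : 0 < x) :
    invSqrtAbs x = ENNReal.ofReal (x ^ (-(1 / 2) : ℝ)) := by
  rw [invSqrtAbs, abs_of_pos hx, ENNReal.ofReal_rpow_of_pos hx]

theorem setLIntegral_invSqrtAbs_Icc_ne_top : ∫⁻ x in Set.Icc (-1) 1, invSqrtAbs x ≠ ∞ := by
  have h1 : ∫⁻ x in Set.Ioc 0 1, invSqrtAbs x ≠ ∞ := by
    rw [setLIntegral_congr_fun measurableSet_Ioc fun x hx => invSqrtAbs_eq_ofReal hx.1]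
    have h := (intervalIntegral.intervalIntegrable_rpow' (a := 0) (b := 1)
      (show (-1 : ℝ) < -(1 / 2) by norm_num)).1
    exact h.lintegral_lt_top.ne
  have h2 : ∫⁻ x in Set.Ico (-1) 0, invSqrtAbs x = ∫⁻ x in Set.Ioc 0 1, invSqrtAbs x := by
    have h := (Measure.measurePreserving_neg (volume : Measure ℝ)).setLIntegral_comp_preimage
      (measurableSet_Ioc (a := (0 : ℝ)) (b := 1)) measurable_invSqrtAbs
    rw [← h]
    simp
  have h3 : Set.Icc (-1 : ℝ) 1 ⊆ (Set.Ico (-1) 0 ∪ {0}) ∪ Set.Ioc 0 1 := by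
    intro x hx
    rcases lt_trichotomy x 0 with h | h | h
    · exact Or.inl (Or.inl ⟨hx.1, h⟩)
    · exact Or.inl (Or.inr h)
    · exact Or.inr ⟨h, hx.2⟩
  refine ne_top_of_le_ne_top ?_ ((lintegral_mono_set h3).trans ((lintegral_union_le _ _ _).trans
    (add_le_add_left (lintegral_union_le _ _ _) _)))
  simp [h1, h2]

theorem exists_setLIntegral_invSqrtAbs_add_le :
    ∃ C : ℝ≥0∞, C ≠ ∞ ∧ ∀ c : ℝ, ∫⁻ x in Set.Icc (-1) 1, invSqrtAbs (x + c) ≤ C := by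
  refine ⟨2 + ∫⁻ x in Set.Icc (-1) 1, invSqrtAbs x,
    ENNReal.add_ne_top.2 ⟨by simp, setLIntegral_invSqrtAbs_Icc_ne_top⟩, fun c => ?_⟩
  -- Only the singularity matters, and its integral over the line is translation invariant; hence
  -- uniformity in `c`.
  have hle : ∀ y, invSqrtAbs y ≤ 1 + (Set.Icc (-1) 1).indicator invSqrtAbs y := by
    intro y
    by_cases hy : y ∈ Set.Icc (-1 : ℝ) 1
    · rw [Set.indicator_of_mem hy]
      exact le_add_self
    · refine le_add_right ?_
      rw [← invSqrtAbs_one]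
      refine invSqrtAbs_le_invSqrtAbs ?_
      rw [abs_one]
      by_contra! h
      exact hy (abs_le.1 h.le)
  calc ∫⁻ x in Set.Icc (-1) 1, invSqrtAbs (x + c)
      ≤ ∫⁻ x in Set.Icc (-1) 1, (1 + (Set.Icc (-1) 1).indicator invSqrtAbs (x + c)) :=
        lintegral_mono fun x => hle _
    _ = 2 + ∫⁻ x in Set.Icc (-1) 1, (Set.Icc (-1) 1).indicator invSqrtAbs (x + c) := by
        rw [lintegral_add_left measurable_const]
        norm_num
    _ ≤ 2 + ∫⁻ x, (Set.Icc (-1) 1).indicator invSqrtAbs (x + c) := by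
        gcongr
        exact Measure.restrict_le_self
    _ = _ := by
        rw [lintegral_add_right_eq_self, lintegral_indicator measurableSet_Icc]

/-- Integrate over the `j`-th coordinate first: factoring out `v j` leaves a translate of
`|x|^{-1/2}`, bounded uniformly in the other coordinates. -/
theorem exists_lintegral_cube_invSqrtAbs_le (m : ℕ) :
    ∃ C : ℝ≥0∞, C ≠ ∞ ∧ ∀ (v : Fin m → ℝ) (j : Fin m),
      ∫⁻ x in Set.pi Set.univ fun _ => Set.Icc (-1) 1, invSqrtAbs (∑ i, x i * v i)
        ≤ C * invSqrtAbs (v j) := by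
  cases m with
  | zero => exact ⟨0, by simp, fun _ j => j.elim0⟩
  | succ k =>
    obtain ⟨C, hC, hle⟩ := exists_setLIntegral_invSqrtAbs_add_le
    set ν : Measure ℝ := volume.restrict (Set.Icc (-1) 1) with hν
    -- The `+ 1` keeps the constant nonzero, so the right side is `∞` when `v j = 0`.
    refine ⟨C * Measure.pi (fun _ : Fin k => ν) Set.univ + 1, ?_, fun v j => ?_⟩
    · exact ENNReal.add_ne_top.2 ⟨ENNReal.mul_ne_top hC (measure_ne_top _ _), by simp⟩
    by_cases hv : v j = 0
    · simp [hv]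
    rw [volume_pi, Measure.restrict_pi_pi]
    rw [← (measurePreserving_piFinSuccAbove (fun _ : Fin (k + 1) => ν) j).symm.lintegral_comp_emb
      (MeasurableEquiv.measurableEmbedding _)]
    refine (lintegral_prod_symm _ (by fun_prop)).trans_le ?_
    have hinner : ∀ y : Fin k → ℝ, ∫⁻ x, invSqrtAbs (∑ i,
        ((MeasurableEquiv.piFinSuccAbove (fun _ : Fin (k + 1) => ℝ) j).symm (x, y)) i * v i) ∂ν
        ≤ C * invSqrtAbs (v j) := by
      intro y
      have : ∀ x, invSqrtAbs (∑ i,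
          ((MeasurableEquiv.piFinSuccAbove (fun _ : Fin (k + 1) => ℝ) j).symm (x, y)) i * v i)
          = invSqrtAbs (x + (∑ i, y i * v (j.succAbove i)) / v j) * invSqrtAbs (v j) := by
        intro x
        rw [← invSqrtAbs_mul, add_mul, div_mul_cancel₀ _ hv, Fin.sum_univ_succAbove _ j]
        simp [MeasurableEquiv.piFinSuccAbove_symm_apply]
      simp_rw [this]
      rw [lintegral_mul_const _ (by fun_prop)]
      gcongr
      exact hle _
    refine (lintegral_mono hinner).trans ?_
    rw [lintegral_const, mul_right_comm]
    gcongr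
    exact le_self_add

/-- `∫ |⟪a, v⟫|^{-1/2} dσ(a) ≤ C |v_j|^{-1/2}`, by polar coordinates from the cube. -/
theorem exists_lintegral_uniformSphere_invSqrtAbs_le (m : ℕ) :
    ∃ C : ℝ≥0∞, C ≠ ∞ ∧ ∀ (v : EuclideanSpace ℝ (Fin m)) (j : Fin m),
      ∫⁻ a, invSqrtAbs (inner ℝ (a : EuclideanSpace ℝ (Fin m)) v) ∂uniformSphere m
        ≤ C * invSqrtAbs (v j) := by
  cases m with
  | zero => exact ⟨0, by simp, fun _ j => j.elim0⟩
  | succ k =>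
  set E := EuclideanSpace ℝ (Fin (k + 1)) with hE
  obtain ⟨C, hC, hle⟩ := exists_lintegral_cube_invSqrtAbs_le (k + 1)
  set σ := (volume : Measure E).toSphere with hσ
  have hσ0 : σ Set.univ ≠ 0 := by
    rw [hσ, Measure.measure_univ_ne_zero]
    exact Measure.toSphere_ne_zero _
  set ρ := Measure.volumeIoiPow (Module.finrank ℝ E - 1) with hρ
  set D := ρ (Set.Iio ⟨1, Set.mem_Ioi.2 one_pos⟩) with hD
  have hD0 : D ≠ 0 := by
    rw [hD, hρ, Measure.volumeIoiPow_apply_Iio]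
    simp
    positivity
  have hDt : D ≠ ∞ := by
    rw [hD, hρ, Measure.volumeIoiPow_apply_Iio]
    simp
  refine ⟨(σ Set.univ)⁻¹ * (D⁻¹ * C), ?_, fun v j => ?_⟩
  · exact ENNReal.mul_ne_top (ENNReal.inv_ne_top.2 hσ0)
      (ENNReal.mul_ne_top (ENNReal.inv_ne_top.2 hD0) hC)
  have hball : ∫⁻ x in Metric.ball (0 : E) 1, invSqrtAbs (inner ℝ x v)
      ≤ C * invSqrtAbs (v j) := by
    refine le_trans ?_ (hle v.ofLp j)
    rw [← (PiLp.volume_preserving_toLp (Fin (k + 1))).setLIntegral_comp_preimage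
      measurableSet_ball (by fun_prop)]
    refine (lintegral_mono_set fun x hx i _ => ?_).trans_eq (lintegral_congr fun x => ?_)
    · have hx' : ‖(WithLp.toLp 2 x : E)‖ ≤ 1 := by simpa using le_of_lt (by simpa using hx)
      exact abs_le.1 (abs_le_one_of_norm_le_one hx' i)
    · congr 1
      exact (PiLp.inner_apply _ _).trans (Finset.sum_congr rfl fun i _ => mul_comm _ _)
  -- Radial projection from the unit ball to the sphere enlarges `|⟪x, v⟫|`, hence decreases the
  -- integrand; `D` is the radial mass of the ball.
  have hpolar : D * ∫⁻ a, invSqrtAbs (inner ℝ (a : E) v) ∂σ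
      ≤ ∫⁻ x in Metric.ball (0 : E) 1, invSqrtAbs (inner ℝ x v) := by
    have h1 := (volume : Measure E).measurePreserving_homeomorphUnitSphereProd.lintegral_comp_emb
      (Homeomorph.measurableEmbedding _) (fun p => invSqrtAbs (inner ℝ (p.1 : E) v) *
        (Set.Iio (⟨1, Set.mem_Ioi.2 one_pos⟩ : Set.Ioi (0 : ℝ))).indicator 1 p.2)
    rw [lintegral_prod_mul
      (f := fun a : Metric.sphere (0 : E) 1 => invSqrtAbs (inner ℝ (a : E) v)) (by fun_prop)
      ((measurable_one.indicator measurableSet_Iio).aemeasurable),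
      lintegral_indicator_one measurableSet_Iio] at h1
    rw [mul_comm, hσ, hD, hρ, ← h1]
    calc _ ≤ ∫⁻ x : ({0}ᶜ : Set E), (Metric.ball (0 : E) 1).indicator
            (fun x => invSqrtAbs (inner ℝ x v)) (x : E)
              ∂((volume : Measure E).comap Subtype.val) := by
          refine lintegral_mono fun x => ?_
          by_cases hx : ‖(x : E)‖ < 1
          · have hx1 : (x : E) ∈ Metric.ball (0 : E) 1 := by simpa using hx
            have hx2 : (homeomorphUnitSphereProd E x).2
                ∈ Set.Iio (⟨1, Set.mem_Ioi.2 one_pos⟩ : Set.Ioi (0 : ℝ)) := by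
              rw [Set.mem_Iio, ← Subtype.coe_lt_coe]
              simpa using hx
            dsimp only
            rw [Set.indicator_of_mem hx1, Set.indicator_of_mem hx2, Pi.one_apply, mul_one]
            refine invSqrtAbs_le_invSqrtAbs ?_
            have hx0 : (0 : ℝ) < ‖(x : E)‖ := norm_pos_iff.2 x.2
            rw [homeomorphUnitSphereProd_apply_fst_coe, inner_smul_left, abs_mul]
            refine le_mul_of_one_le_left (abs_nonneg _) ?_
            rw [conj_trivial, abs_of_pos (inv_pos.2 hx0)]
            exact (one_le_inv₀ hx0).2 hx.le
          · have hx2 : (homeomorphUnitSphereProd E x).2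
                ∉ Set.Iio (⟨1, Set.mem_Ioi.2 one_pos⟩ : Set.Ioi (0 : ℝ)) := by
              rw [Set.mem_Iio, ← Subtype.coe_lt_coe]
              simpa using hx
            dsimp only
            rw [Set.indicator_of_notMem hx2, mul_zero]
            exact zero_le
      _ ≤ ∫⁻ x : E, (Metric.ball (0 : E) 1).indicator (fun x => invSqrtAbs (inner ℝ x v)) x := by
          rw [lintegral_subtype_comap (measurableSet_singleton _).compl]
          exact setLIntegral_le_lintegral _ _
      _ = _ := lintegral_indicator measurableSet_ball _
  rw [uniformSphere, lintegral_smul_measure, smul_eq_mul, mul_assoc, mul_assoc]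
  gcongr
  rw [← ENNReal.mul_le_iff_le_inv hD0 hDt]
  exact hpolar.trans hball

/-! ### Negative moments of random minors -/

/-- The leading `k × k` minor of the matrix with rows `a 0, …, a (k - 1)`. -/
noncomputable def leadingMinor {m k : ℕ} (hk : k ≤ m)
    (a : Fin k → Metric.sphere (0 : EuclideanSpace ℝ (Fin m)) 1) : ℝ :=
  (Matrix.of fun i j => (a i : EuclideanSpace ℝ (Fin m)) (Fin.castLE hk j)).det

theorem continuous_leadingMinor {m k : ℕ} (hk : k ≤ m) :
    Continuous (leadingMinor (m := m) hk) := by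
  unfold leadingMinor
  refine Continuous.matrix_det (continuous_matrix fun i j => ?_)
  simp only [Matrix.of_apply]
  fun_prop

/-- Laplace expansion along the first row. -/
theorem exists_leadingMinor_cons_eq_inner {m k : ℕ} (hk : k + 1 ≤ m)
    (a : Fin k → Metric.sphere (0 : EuclideanSpace ℝ (Fin m)) 1) :
    ∃ v : EuclideanSpace ℝ (Fin m),
      |v (Fin.castLE hk (Fin.last k))| = |leadingMinor (Nat.le_of_succ_le hk) a| ∧
      ∀ b : Metric.sphere (0 : EuclideanSpace ℝ (Fin m)) 1,
        leadingMinor hk (Fin.cons b a) = inner ℝ (b : EuclideanSpace ℝ (Fin m)) v := by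
  set c : Fin (k + 1) → ℝ := fun j => (-1) ^ (j : ℕ) * (Matrix.of fun (i j' : Fin k) =>
    (a i : EuclideanSpace ℝ (Fin m)) (Fin.castLE hk (j.succAbove j'))).det with hc
  refine ⟨∑ j, EuclideanSpace.single (Fin.castLE hk j) (c j), ?_, fun b => ?_⟩
  · have h : (∑ j, EuclideanSpace.single (Fin.castLE hk j) (c j)) (Fin.castLE hk (Fin.last k))
        = c (Fin.last k) := by
      simp only [WithLp.ofLp_sum, Finset.sum_apply, PiLp.single_apply,
        (Fin.castLE_injective hk).eq_iff]
      simp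
    rw [h, hc]
    simp only [abs_mul, abs_pow, abs_neg, abs_one, one_pow, one_mul, Fin.succAbove_last]
    rfl
  · rw [inner_sum, leadingMinor, Matrix.det_succ_row_zero]
    refine Finset.sum_congr rfl fun j _ => ?_
    rw [EuclideanSpace.inner_single_right, hc]
    simp only [Matrix.of_apply, Fin.cons_zero, conj_trivial]
    rw [mul_right_comm]
    rfl

/-- With the other rows fixed, the minor is linear in the first row, and one coefficient is, up to
sign, the next smaller leading minor. Integrating out that row costs a factor `C`; induct on `k`. -/
theorem exists_lintegral_invSqrtAbs_leadingMinor_le (m : ℕ) (hm : 1 ≤ m) :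
    ∃ C : ℝ≥0∞, C ≠ ∞ ∧ ∀ (k : ℕ) (hk : k ≤ m),
      ∫⁻ a, invSqrtAbs (leadingMinor hk a) ∂Measure.pi (fun _ : Fin k => uniformSphere m)
        ≤ C ^ k := by
  have := isProbabilityMeasure_uniformSphere m hm
  obtain ⟨C, hC, hle⟩ := exists_lintegral_uniformSphere_invSqrtAbs_le m
  refine ⟨C, hC, fun k => ?_⟩
  induction k with
  | zero =>
    intro hk
    simp [leadingMinor]
  | succ k ih =>
    intro hk
    have hmeas : Measurable fun a => invSqrtAbs (leadingMinor (m := m) hk a) :=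
      measurable_invSqrtAbs.comp (continuous_leadingMinor hk).measurable
    rw [← (measurePreserving_piFinSuccAbove (fun _ : Fin (k + 1) => uniformSphere m)
      0).symm.lintegral_comp_emb (MeasurableEquiv.measurableEmbedding _)]
    refine (lintegral_prod_symm _
      (hmeas.comp (MeasurableEquiv.measurable _)).aemeasurable).trans_le ?_
    refine (lintegral_mono (g := fun a => C * invSqrtAbs (leadingMinor (Nat.le_of_succ_le hk) a))
      fun a => ?_).trans ?_
    · obtain ⟨v, hv, hv'⟩ := exists_leadingMinor_cons_eq_inner hk a
      refine le_trans (lintegral_mono fun b => ?_) ((hle v (Fin.castLE hk (Fin.last k))).trans ?_)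
      · have : (MeasurableEquiv.piFinSuccAbove (fun _ : Fin (k + 1) =>
            Metric.sphere (0 : EuclideanSpace ℝ (Fin m)) 1) 0).symm (b, a) = Fin.cons b a := by
          rw [MeasurableEquiv.piFinSuccAbove_symm_apply]
          exact Fin.insertNth_zero' _ _
        rw [Function.comp_apply, this, hv']
      · dsimp only
        gcongr
        exact invSqrtAbs_le_invSqrtAbs hv.ge
    · have hmeas' : Measurable fun a => invSqrtAbs (leadingMinor (Nat.le_of_succ_le hk) a) :=
        measurable_invSqrtAbs.comp (continuous_leadingMinor _).measurable
      rw [lintegral_const_mul _ hmeas', pow_succ']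
      gcongr
      exact ih _

/-- The `m × m` minors of a matrix with independent uniform rows have `|det|^{-1/2}` integrable,
uniformly in the choice of the rows. -/
theorem exists_lintegral_invSqrtAbs_minor_le {Ω : Type*} [MeasurableSpace Ω] (P : Measure Ω)
    [IsProbabilityMeasure P] (m : ℕ) (hm : 1 ≤ m)
    (A : ℕ → Ω → Metric.sphere (0 : EuclideanSpace ℝ (Fin m)) 1)
    (hlaw : ∀ i, HasLaw (A i) (uniformSphere m) P) (hindep : iIndepFun A P) :
    ∃ C : ℝ≥0∞, C ≠ ∞ ∧ ∀ (n : ℕ) (e : Fin m ↪ Fin n),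
      ∫⁻ ω, invSqrtAbs ((rowMatrix A n ω).submatrix e id).det ∂P ≤ C := by
  obtain ⟨C, hC, hle⟩ := exists_lintegral_invSqrtAbs_leadingMinor_le m hm
  refine ⟨C ^ m, ENNReal.pow_ne_top hC, fun n e => ?_⟩
  have hind := hindep.precomp (Fin.val_injective.comp e.injective)
  have hae : ∀ i : Fin m, AEMeasurable (A (e i)) P := fun i => (hlaw _).aemeasurable
  have hmap := (iIndepFun_iff_map_fun_eq_pi_map hae).1 hind
  refine le_trans (le_of_eq ?_) (hle m le_rfl)
  have hmap' : P.map (fun ω i => A (e i) ω) = Measure.pi fun _ : Fin m => uniformSphere m := by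
    refine hmap.trans ?_
    congr 1
    funext i
    exact (hlaw _).map_eq
  rw [← hmap', lintegral_map' ?_ (aemeasurable_pi_lambda _ hae)]
  · rfl
  · exact (measurable_invSqrtAbs.comp (continuous_leadingMinor _).measurable).aemeasurable

theorem norm_row_rowMatrix {Ω : Type*} {m : ℕ}
    (A : ℕ → Ω → Metric.sphere (0 : EuclideanSpace ℝ (Fin m)) 1) (n : ℕ) (ω : Ω) (i : Fin n) :
    ‖row (rowMatrix A n ω) i‖ = 1 :=
  norm_eq_of_mem_sphere (A i ω)

/-! ### Moment bounds for `log 𝒞` -/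

/-- `(log x)^γ ≤ (4 γ)^γ x^{1/4}` for `x ∈ [1, ∞]`. -/
theorem log_toENNReal_rpow_le {γ : ℝ} (hγ : 0 < γ) {x : ℝ≥0∞} (hx : 1 ≤ x) :
    (ENNReal.log x).toENNReal ^ γ ≤ ENNReal.ofReal ((4 * γ) ^ γ) * x ^ (1 / 4 : ℝ) := by
  have hK : 0 < (4 * γ) ^ γ := by positivity
  rcases eq_or_ne x ∞ with rfl | hxt
  · rw [ENNReal.top_rpow_of_pos (by norm_num), ENNReal.mul_top (by simpa using hK)]
    exact le_top
  have hx1 : 1 ≤ x.toReal := by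
    simpa using (ENNReal.toReal_le_toReal ENNReal.one_ne_top hxt).2 hx
  have hx0 : 0 < x.toReal := zero_lt_one.trans_le hx1
  have hlog : 0 ≤ Real.log x.toReal := Real.log_nonneg hx1
  rw [ENNReal.log_pos_real (by positivity) hxt, EReal.toENNReal_of_ne_top (by simp)]
  rw [EReal.toReal_coe, ENNReal.ofReal_rpow_of_nonneg hlog hγ.le]
  nth_rw 2 [← ENNReal.ofReal_toReal hxt]
  rw [ENNReal.ofReal_rpow_of_pos hx0, ← ENNReal.ofReal_mul hK.le]
  refine ENNReal.ofReal_le_ofReal ?_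
  -- The exponent `1 / (4 γ)` becomes `1 / 4` after raising to the power `γ`.
  have h1 := Real.log_le_rpow_div hx0.le (show 0 < 1 / (4 * γ) by positivity)
  refine (Real.rpow_le_rpow hlog h1 hγ.le).trans_eq ?_
  rw [div_div_eq_mul_div, div_one, Real.mul_rpow (by positivity) (by positivity),
    ← Real.rpow_mul hx0.le, mul_comm]
  congr 2
  field_simp

theorem inv_ofReal_abs_rpow_le {c d M : ℝ} (hM : 0 < M) (h : |d| ≤ M * |c|) :
    (ENNReal.ofReal |c|)⁻¹ ^ (1 / 4 : ℝ)
      ≤ ENNReal.ofReal M ^ (1 / 4 : ℝ) * invSqrtAbs d ^ (1 / 2 : ℝ) := by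
  have h1 : (ENNReal.ofReal |c|)⁻¹ ≤ ENNReal.ofReal M * (ENNReal.ofReal |d|)⁻¹ := by
    have hM0 : ENNReal.ofReal M ≠ 0 := by simpa using hM
    rw [mul_comm, ← ENNReal.div_le_iff_le_mul (Or.inl hM0) (Or.inl ENNReal.ofReal_ne_top),
      div_eq_mul_inv, ← ENNReal.mul_inv (Or.inr ENNReal.ofReal_ne_top) (Or.inr hM0),
      ENNReal.inv_le_inv, ← ENNReal.ofReal_mul (abs_nonneg _), mul_comm]
    exact ENNReal.ofReal_le_ofReal h
  have h2 : invSqrtAbs d ^ (1 / 2 : ℝ) = (ENNReal.ofReal |d|)⁻¹ ^ (1 / 4 : ℝ) := by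
    rw [invSqrtAbs, ← ENNReal.rpow_mul, ENNReal.inv_rpow, ← ENNReal.rpow_neg]
    norm_num
  rw [h2, ← ENNReal.mul_rpow_of_nonneg _ _ (by norm_num)]
  gcongr

/-- The controlling minor depends on `A`; summing over all choices of rows removes this dependence.
The power `1 / 2` of `|det|^{-1/2}` leaves room for Cauchy–Schwarz. -/
theorem exists_logCondNumber_rpow_le_sum {γ : ℝ} (hγ : 0 < γ) {m : ℕ} (hm : 1 ≤ m) :
    ∃ K : ℝ≥0∞, K ≠ ∞ ∧ ∀ (n : ℕ), m ≤ n → ∀ (A : Matrix (Fin n) (Fin m) ℝ),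
      (∀ i, ‖row A i‖ = 1) → logCondNumber A ^ γ
        ≤ K * ∑ e : Fin m ↪ Fin n, invSqrtAbs (A.submatrix e id).det ^ (1 / 2 : ℝ) := by
  refine ⟨ENNReal.ofReal ((4 * γ) ^ γ) * ENNReal.ofReal (m * m.factorial) ^ (1 / 4 : ℝ),
    ENNReal.mul_ne_top ENNReal.ofReal_ne_top
      (ENNReal.rpow_ne_top_of_nonneg (by norm_num) ENNReal.ofReal_ne_top),
    fun n hn A hA => ?_⟩
  obtain ⟨e, he⟩ := exists_minor_le_abs_cos_theta hm hn A hA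
  refine (log_toENNReal_rpow_le hγ (one_le_condNumber A)).trans ?_
  rw [mul_assoc]
  gcongr
  refine (inv_ofReal_abs_rpow_le (by positivity) he).trans ?_
  gcongr
  exact Finset.single_le_sum
    (f := fun e : Fin m ↪ Fin n => invSqrtAbs (A.submatrix e id).det ^ (1 / 2 : ℝ))
    (fun _ _ => zero_le) (Finset.mem_univ e)

theorem setLIntegral_rpow_half_le {Ω : Type*} [MeasurableSpace Ω] (P : Measure Ω)
    {g : Ω → ℝ≥0∞} (hg : AEMeasurable g P) (T : Set Ω) :
    ∫⁻ ω in T, g ω ^ (1 / 2 : ℝ) ∂P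
      ≤ (∫⁻ ω, g ω ∂P) ^ (1 / 2 : ℝ) * P T ^ (1 / 2 : ℝ) := by
  have h := ENNReal.lintegral_mul_le_Lp_mul_Lq (P.restrict T) Real.HolderConjugate.two_two
    (hg.restrict.pow_const (1 / 2 : ℝ)) (measurable_const (a := (1 : ℝ≥0∞))).aemeasurable
  simp only [Pi.mul_apply, mul_one, ENNReal.one_rpow, lintegral_const, one_mul,
    Measure.restrict_apply_univ, ← ENNReal.rpow_mul] at h
  norm_num at h
  refine le_trans (by norm_num) (h.trans ?_)
  norm_num
  gcongr
  exact Measure.restrict_le_self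

/-- The supremum is uncountable, but a bounded supremum of continuous functions is lower
semicontinuous. -/
theorem measurable_theta {n m : ℕ} (hn : 1 ≤ n) :
    Measurable fun a : Fin n → Metric.sphere (0 : EuclideanSpace ℝ (Fin m)) 1 =>
      theta (Matrix.of fun i j => (a i : EuclideanSpace ℝ (Fin m)) j) := by
  have : Nonempty (Fin n) := ⟨⟨0, hn⟩⟩
  refine LowerSemicontinuous.measurable ?_
  unfold theta
  refine lowerSemicontinuous_ciSup (fun a => ⟨Real.pi, ?_⟩) fun x => ?_
  · rintro _ ⟨x, rfl⟩
    exact (ciInf_le (Set.finite_range _).bddBelow ⟨0, hn⟩).trans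
      (InnerProductGeometry.angle_le_pi _ _)
  · refine Continuous.lowerSemicontinuous ?_
    simp only [minAngle, ← Finset.inf'_univ_eq_ciInf]
    refine Continuous.finset_inf'_apply _ fun i _ => ?_
    refine continuous_iff_continuousAt.2 fun a => ?_
    have ha : (a i : EuclideanSpace ℝ (Fin m)) ≠ 0 := ne_zero_of_mem_unit_sphere _
    exact (InnerProductGeometry.continuousAt_angle
      (x := ((a i : EuclideanSpace ℝ (Fin m)), (x : EuclideanSpace ℝ (Fin m)))) ha x.2).comp
      (f := fun b : Fin n → Metric.sphere (0 : EuclideanSpace ℝ (Fin m)) 1 =>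
        ((b i : EuclideanSpace ℝ (Fin m)), (x : EuclideanSpace ℝ (Fin m))))
      ((continuous_subtype_val.comp (continuous_apply i)).prodMk continuous_const).continuousAt

theorem aemeasurable_logCondNumber {Ω : Type*} [MeasurableSpace Ω] {P : Measure Ω} {m n : ℕ}
    (hn : 1 ≤ n) {A : ℕ → Ω → Metric.sphere (0 : EuclideanSpace ℝ (Fin m)) 1}
    (hA : ∀ i, AEMeasurable (A i) P) :
    AEMeasurable (fun ω => logCondNumber (rowMatrix A n ω)) P := by
  have h : Measurable fun a : Fin n → Metric.sphere (0 : EuclideanSpace ℝ (Fin m)) 1 =>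
      logCondNumber (Matrix.of fun i j => (a i : EuclideanSpace ℝ (Fin m)) j) := by
    unfold logCondNumber condNumber
    refine (ENNReal.measurable_log.comp (Measurable.inv ?_)).ereal_toENNReal
    exact ENNReal.measurable_ofReal.comp
      (continuous_abs.measurable.comp (Real.measurable_cos.comp (measurable_theta hn)))
  exact h.comp_aemeasurable (aemeasurable_pi_lambda (fun ω (i : Fin n) => A i ω) fun i => hA i)

/-- Cauchy–Schwarz bound for the part of the moment carried by a set `T`. -/
theorem exists_setLIntegral_logCondNumber_rpow_le {Ω : Type*} [MeasurableSpace Ω] (P : Measure Ω)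
    [IsProbabilityMeasure P] {m : ℕ} (hm : 1 ≤ m)
    (A : ℕ → Ω → Metric.sphere (0 : EuclideanSpace ℝ (Fin m)) 1)
    (hlaw : ∀ i, HasLaw (A i) (uniformSphere m) P) (hindep : iIndepFun A P)
    {γ : ℝ} (hγ : 0 < γ) :
    ∃ K : ℝ≥0∞, K ≠ ∞ ∧ ∀ n, m ≤ n → ∀ T : Set Ω,
      ∫⁻ ω in T, logCondNumber (rowMatrix A n ω) ^ γ ∂P ≤ K * (n : ℝ≥0∞) ^ m * P T ^ (1 / 2 : ℝ) := by
  obtain ⟨K, hK, hle⟩ := exists_logCondNumber_rpow_le_sum hγ hm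
  obtain ⟨C, hC, hmom⟩ := exists_lintegral_invSqrtAbs_minor_le P m hm A hlaw hindep
  refine ⟨K * C ^ (1 / 2 : ℝ), ENNReal.mul_ne_top hK
    (ENNReal.rpow_ne_top_of_nonneg (by norm_num) hC), fun n hn T => ?_⟩
  have hmeas : ∀ e : Fin m ↪ Fin n,
      AEMeasurable (fun ω => invSqrtAbs ((rowMatrix A n ω).submatrix e id).det) P := by
    intro e
    exact (measurable_invSqrtAbs.comp (continuous_leadingMinor le_rfl).measurable).comp_aemeasurable
      (aemeasurable_pi_lambda (fun ω (i : Fin m) => A (e i) ω) fun i => (hlaw _).aemeasurable)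
  calc ∫⁻ ω in T, logCondNumber (rowMatrix A n ω) ^ γ ∂P
      ≤ ∫⁻ ω in T, K * ∑ e : Fin m ↪ Fin n,
          invSqrtAbs ((rowMatrix A n ω).submatrix e id).det ^ (1 / 2 : ℝ) ∂P :=
        lintegral_mono fun ω => hle n hn _ (norm_row_rowMatrix A n ω)
    _ = K * ∑ e : Fin m ↪ Fin n,
          ∫⁻ ω in T, invSqrtAbs ((rowMatrix A n ω).submatrix e id).det ^ (1 / 2 : ℝ) ∂P := by
        rw [lintegral_const_mul' _ _ hK,
          lintegral_finsetSum' _ fun e _ => ((hmeas e).restrict.pow_const _)]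
    _ ≤ K * ∑ _e : Fin m ↪ Fin n, C ^ (1 / 2 : ℝ) * P T ^ (1 / 2 : ℝ) := by
        gcongr with e
        refine (setLIntegral_rpow_half_le P (hmeas e) T).trans ?_
        gcongr
        exact hmom n e
    _ ≤ K * ((n : ℝ≥0∞) ^ m * (C ^ (1 / 2 : ℝ) * P T ^ (1 / 2 : ℝ))) := by
        rw [Finset.sum_const, nsmul_eq_mul, Finset.card_univ, Fintype.card_embedding_eq,
          Fintype.card_fin, Fintype.card_fin]
        gcongr
        exact_mod_cast Nat.descFactorial_le_pow n m
    _ = _ := by ring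

/-! ### Exponential concentration and the limit -/

theorem uniformSphere_ball_compl_lt_one {m : ℕ} (hm : 1 ≤ m)
    (c : Metric.sphere (0 : EuclideanSpace ℝ (Fin m)) 1) {r : ℝ} (hr : 0 < r) :
    uniformSphere m (Metric.ball c r)ᶜ < 1 := by
  have := isProbabilityMeasure_uniformSphere m hm
  have hpos : uniformSphere m (Metric.ball c r) ≠ 0 := by
    rw [uniformSphere, Measure.smul_apply, smul_eq_mul]
    exact mul_ne_zero (ENNReal.inv_ne_zero.2 (measure_ne_top _ _))
      (Metric.measure_ball_pos _ _ hr).ne'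
  rw [prob_compl_eq_one_sub measurableSet_ball]
  exact ENNReal.sub_lt_self ENNReal.one_ne_top one_ne_zero hpos

/-- The probability that `cos θ(A^{[n]})` is not close to `1` decays exponentially in `n`. -/
theorem exists_measure_cos_theta_lt_le {Ω : Type*} [MeasurableSpace Ω] (P : Measure Ω)
    [IsProbabilityMeasure P] {m : ℕ} (hm : 1 ≤ m)
    (A : ℕ → Ω → Metric.sphere (0 : EuclideanSpace ℝ (Fin m)) 1)
    (hlaw : ∀ i, HasLaw (A i) (uniformSphere m) P) (hindep : iIndepFun A P)
    {r : ℝ} (hr : 0 < r) :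
    ∃ (N : ℕ) (q : ℝ≥0∞), q < 1 ∧ ∀ n, 1 ≤ n →
      P {ω | Real.cos (theta (rowMatrix A n ω)) < 1 - 2 * r ^ 2} ≤ N * q ^ n := by
  obtain ⟨t, -, htfin, ht⟩ :=
    (isCompact_univ (X := Metric.sphere (0 : EuclideanSpace ℝ (Fin m)) 1)).finite_cover_balls hr
  lift t to Finset (Metric.sphere (0 : EuclideanSpace ℝ (Fin m)) 1) using htfin
  refine ⟨t.card, t.sup fun c => uniformSphere m (Metric.ball c r)ᶜ,
    (Finset.sup_lt_iff zero_lt_one).2 fun c _ => uniformSphere_ball_compl_lt_one hm c hr,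
    fun n hn => ?_⟩
  -- If every ball contains a row, each unit vector is within `2 r` of a row through the centre of
  -- its ball.
  have hsub : {ω | Real.cos (theta (rowMatrix A n ω)) < 1 - 2 * r ^ 2}
      ⊆ ⋃ c ∈ t, ⋂ i ∈ Finset.range n, A i ⁻¹' (Metric.ball c r)ᶜ := by
    intro ω hω
    by_contra hnot
    refine absurd (le_cos_theta_of_net hn hm _ (norm_row_rowMatrix A n ω) r fun y hy => ?_)
      (not_le.2 hω)
    obtain ⟨c, hc, hyc⟩ := Set.mem_iUnion₂.1
      (ht (Set.mem_univ (⟨y, by simpa using hy⟩ : Metric.sphere (0 : EuclideanSpace ℝ (Fin m)) 1)))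
    simp only [Set.mem_iUnion, Set.mem_iInter, not_exists, not_forall] at hnot
    obtain ⟨i, hi, hic⟩ := hnot c hc
    refine ⟨⟨i, Finset.mem_range.1 hi⟩, ?_⟩
    have h1 : dist (A i ω) c < r := by simpa using hic
    have h2 := dist_triangle_right (A i ω) ⟨y, by simpa using hy⟩ c
    have h3 : dist (⟨y, by simpa using hy⟩ : Metric.sphere (0 : EuclideanSpace ℝ (Fin m)) 1) c < r :=
      hyc
    refine le_trans (le_of_eq ?_) (h2.trans (by linarith))
    rfl
  refine (measure_mono hsub).trans ((measure_biUnion_finset_le _ _).trans ?_)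
  rw [← nsmul_eq_mul]
  refine Finset.sum_le_card_nsmul _ _ _ fun c hc => ?_
  rw [hindep.measure_inter_preimage_eq_mul _ fun _ _ => measurableSet_ball.compl]
  refine (Finset.prod_le_pow_card _ _ _ fun i _ => ?_).trans_eq (by rw [Finset.card_range])
  rw [← Measure.map_apply_of_aemeasurable (hlaw i).aemeasurable measurableSet_ball.compl,
    (hlaw i).map_eq]
  exact Finset.le_sup (f := fun c => uniformSphere m (Metric.ball c r)ᶜ) hc

theorem logCondNumber_le_of_le_cos {n m : ℕ} {A : Matrix (Fin n) (Fin m) ℝ} {s : ℝ}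
    (h : s ≤ Real.cos (theta A)) :
    logCondNumber A ≤ (ENNReal.log (ENNReal.ofReal s)⁻¹).toENNReal := by
  unfold logCondNumber condNumber
  refine EReal.toENNReal_le_toENNReal (ENNReal.log_monotone (ENNReal.inv_le_inv.2 ?_))
  exact ENNReal.ofReal_le_ofReal (h.trans (le_abs_self _))

theorem tendsto_log_inv_rpow {γ : ℝ} (hγ : 0 < γ) :
    Tendsto (fun r : ℝ => (ENNReal.log (ENNReal.ofReal (1 - 2 * r ^ 2))⁻¹).toENNReal ^ γ)
      (𝓝 0) (𝓝 0) := by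
  have hc : Continuous fun r : ℝ =>
      (ENNReal.log (ENNReal.ofReal (1 - 2 * r ^ 2))⁻¹).toENNReal ^ γ := by
    refine ENNReal.continuous_rpow_const.comp (EReal.continuous_toENNReal.comp
      (ENNReal.continuous_log.comp (continuous_inv.comp (ENNReal.continuous_ofReal.comp ?_))))
    fun_prop
  simpa [hγ] using hc.tendsto 0

theorem tendsto_natCast_pow_mul_rpow_half (m : ℕ) {q : ℝ≥0∞} (hq : q < 1) {K : ℝ≥0∞} (hK : K ≠ ∞)
    (N : ℕ) :
    Tendsto (fun n : ℕ => K * (n : ℝ≥0∞) ^ m * ((N : ℝ≥0∞) * q ^ n) ^ (1 / 2 : ℝ))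
      atTop (𝓝 0) := by
  set s : ℝ≥0∞ := q ^ (1 / 2 : ℝ) with hs
  have hs1 : s < 1 := ENNReal.rpow_lt_one hq (by norm_num)
  have hst : s ≠ ∞ := (hs1.trans ENNReal.one_lt_top).ne
  have hlim : Tendsto (fun n : ℕ => (n : ℝ≥0∞) ^ m * s ^ n) atTop (𝓝 0) := by
    have hs' : |s.toReal| < 1 := by
      rw [abs_of_nonneg ENNReal.toReal_nonneg]
      simpa using (ENNReal.toReal_lt_toReal hst ENNReal.one_ne_top).2 hs1
    have h := ENNReal.tendsto_ofReal (tendsto_pow_const_mul_const_pow_of_abs_lt_one m hs')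
    rw [ENNReal.ofReal_zero] at h
    refine h.congr fun n => ?_
    rw [ENNReal.ofReal_mul (by positivity), ENNReal.ofReal_pow (by positivity),
      ENNReal.ofReal_pow ENNReal.toReal_nonneg, ENNReal.ofReal_natCast, ENNReal.ofReal_toReal hst]
  have hKN : K * (N : ℝ≥0∞) ^ (1 / 2 : ℝ) ≠ ∞ := ENNReal.mul_ne_top hK
    (ENNReal.rpow_ne_top_of_nonneg (by norm_num) (ENNReal.natCast_ne_top N))
  have h := ENNReal.Tendsto.const_mul hlim (Or.inr hKN)
  rw [mul_zero] at h
  refine h.congr fun n => ?_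
  have hsn : (q ^ n) ^ (1 / 2 : ℝ) = s ^ n := by
    rw [hs, ← ENNReal.rpow_natCast, ← ENNReal.rpow_natCast, ← ENNReal.rpow_mul,
      ← ENNReal.rpow_mul, mul_comm]
  rw [ENNReal.mul_rpow_of_nonneg _ _ (by norm_num), hsn]
  ring

theorem tendsto_lintegral_logCondNumber_rpow {Ω : Type*} [MeasurableSpace Ω] (P : Measure Ω)
    [IsProbabilityMeasure P] {m : ℕ} (hm : 1 ≤ m)
    (A : ℕ → Ω → Metric.sphere (0 : EuclideanSpace ℝ (Fin m)) 1)
    (hlaw : ∀ i, HasLaw (A i) (uniformSphere m) P) (hindep : iIndepFun A P)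
    {γ : ℝ} (hγ : 0 < γ) :
    Tendsto (fun n => ∫⁻ ω, logCondNumber (rowMatrix A n ω) ^ γ ∂P) atTop (𝓝 0) := by
  obtain ⟨K, hK, hbound⟩ := exists_setLIntegral_logCondNumber_rpow_le P hm A hlaw hindep hγ
  rw [ENNReal.tendsto_nhds_zero]
  intro ε hε
  have hε2 : 0 < ε / 2 := ENNReal.half_pos hε.ne'
  obtain ⟨r, hrε, hr⟩ := ((((tendsto_log_inv_rpow hγ).mono_left
    (nhdsWithin_le_nhds (s := Set.Ioi 0))).eventually_le_const hε2).and
    self_mem_nhdsWithin).exists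
  obtain ⟨N, q, hq, hprob⟩ := exists_measure_cos_theta_lt_le P hm A hlaw hindep hr
  filter_upwards [(tendsto_natCast_pow_mul_rpow_half m hq hK N).eventually_le_const hε2,
    eventually_ge_atTop m] with n hn hmn
  set B := {ω | Real.cos (theta (rowMatrix A n ω)) < 1 - 2 * r ^ 2} with hB
  -- The rows are only a.e. measurable, so `B` is replaced by a measurable hull of the same
  -- probability.
  set T := toMeasurable P B with hT
  have hTm : MeasurableSet T := measurableSet_toMeasurable P B
  rw [← lintegral_add_compl _ hTm, ← ENNReal.add_halves ε]
  refine add_le_add ((hbound n hmn T).trans (le_trans ?_ hn)) ?_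
  · rw [hT, measure_toMeasurable]
    gcongr
    exact hprob n (hm.trans hmn)
  · refine (setLIntegral_mono' (g := fun _ => ε / 2) hTm.compl fun ω hω => ?_).trans ?_
    · have hωB : ω ∉ B := fun h => hω (subset_toMeasurable P B h)
      refine le_trans ?_ hrε
      gcongr
      exact logCondNumber_le_of_le_cos (not_lt.1 hωB)
    · rw [setLIntegral_const]
      exact mul_le_of_le_one_right' prob_le_one

end CondNumber

theorem mainTheorem9 {Ω : Type*} [MeasurableSpace Ω] (P : Measure Ω) [IsProbabilityMeasure P]
    (m : ℕ) (hm : 3 ≤ m)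
    (A : ℕ → Ω → Metric.sphere (0 : EuclideanSpace ℝ (Fin m)) 1)
    (hlaw : ∀ i, HasLaw (A i) (CondNumber.uniformSphere m) P)
    (hindep : iIndepFun A P) :
    -- the moments of `log 𝒞(A^{[n]})`, as integrals with values in `[0, ∞]`, tend to `0`
    (∀ γ : ℝ, 0 < γ →
      Tendsto (fun n => ∫⁻ ω, CondNumber.logCondNumber (CondNumber.rowMatrix A n ω) ^ γ ∂P)
        atTop (𝓝 0)) ∧
    -- for `n ≥ m`, `log 𝒞(A^{[n]})` is almost surely finite and square integrable
    (∀ n, m ≤ n →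
      (∀ᵐ ω ∂P, CondNumber.logCondNumber (CondNumber.rowMatrix A n ω) < ∞) ∧
      MemLp (fun ω => (CondNumber.logCondNumber (CondNumber.rowMatrix A n ω)).toReal) 2 P) ∧
    -- its expectation and its variance tend to `0`
    Tendsto (fun n => ∫ ω, (CondNumber.logCondNumber (CondNumber.rowMatrix A n ω)).toReal ∂P)
      atTop (𝓝 0) ∧
    Tendsto
      (fun n => variance
        (fun ω => (CondNumber.logCondNumber (CondNumber.rowMatrix A n ω)).toReal) P)
      atTop (𝓝 0) := by
  have hm1 : 1 ≤ m := by omega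
  have hmoment := fun γ hγ =>
    CondNumber.tendsto_lintegral_logCondNumber_rpow P hm1 A hlaw hindep (γ := γ) hγ
  have hae : ∀ n, m ≤ n →
      AEMeasurable (fun ω => CondNumber.logCondNumber (CondNumber.rowMatrix A n ω)) P :=
    fun n hn => CondNumber.aemeasurable_logCondNumber (hm1.trans hn) fun i => (hlaw i).aemeasurable
  have hfin : ∀ n, m ≤ n →
      ∫⁻ ω, CondNumber.logCondNumber (CondNumber.rowMatrix A n ω) ^ (2 : ℝ) ∂P ≠ ∞ := by
    intro n hn
    obtain ⟨K, hK, hbound⟩ :=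
      CondNumber.exists_setLIntegral_logCondNumber_rpow_le P hm1 A hlaw hindep two_pos
    -- On the whole space the bound grows with `n`, but gives a finite second moment for each `n`.
    have h := hbound n hn Set.univ
    rw [setLIntegral_univ, measure_univ, ENNReal.one_rpow, mul_one] at h
    exact ne_top_of_le_ne_top
      (ENNReal.mul_ne_top hK (ENNReal.pow_ne_top (ENNReal.natCast_ne_top n))) h
  have hlt : ∀ n, m ≤ n →
      ∀ᵐ ω ∂P, CondNumber.logCondNumber (CondNumber.rowMatrix A n ω) < ∞ := by
    intro n hn
    filter_upwards [ae_lt_top' ((hae n hn).pow_const _) (hfin n hn)] with ω hω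
    exact (ENNReal.rpow_lt_top_iff_of_pos two_pos).1 hω
  refine ⟨hmoment, fun n hn => ⟨hlt n hn, (hae n hn).ennreal_toReal.aestronglyMeasurable, ?_⟩,
    ?_, ?_⟩
  · rw [eLpNorm_lt_top_iff_lintegral_rpow_enorm_lt_top two_ne_zero ENNReal.ofNat_ne_top]
    refine (lintegral_mono fun ω => ?_).trans_lt (hfin n hn).lt_top
    rw [ENNReal.toReal_ofNat, Real.enorm_of_nonneg ENNReal.toReal_nonneg]
    gcongr
    exact ENNReal.ofReal_toReal_le
  · have h := (ENNReal.tendsto_toReal ENNReal.zero_ne_top).comp (hmoment 1 one_pos)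
    refine h.congr' ?_
    filter_upwards [eventually_ge_atTop m] with n hn
    simp only [Function.comp_apply, ENNReal.rpow_one]
    exact (integral_toReal (hae n hn) (hlt n hn)).symm
  · have h := (ENNReal.tendsto_toReal ENNReal.zero_ne_top).comp (hmoment 2 two_pos)
    refine tendsto_of_tendsto_of_tendsto_of_le_of_le' tendsto_const_nhds h
      (Eventually.of_forall fun n => variance_nonneg _ _) ?_
    filter_upwards [eventually_ge_atTop m] with n hn
    refine (variance_le_expectation_sq (hae n hn).ennreal_toReal.aestronglyMeasurable).trans_eq ?_
    rw [Function.comp_apply, ← integral_toReal ((hae n hn).pow_const _)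
      (by filter_upwards [hlt n hn] with ω hω
          exact (ENNReal.rpow_lt_top_iff_of_pos two_pos).2 hω)]
    simp
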